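/- Let $G$ be a finite connected undirected graph, possibly with loops and multiple edges, with $n$ vertices, $m$ edges and genus $g=m-n+1$. Let $T(x,y)$ be the Tutte polynomial of $G$ and let $R(p)=(1-p)^{n-1}p^{g}\,T(1,1/p)$ be its reliability polynomial. Fix a total order $<$ on the edges of $G$ and a reference orientation $A$ of all edges of $G$. A partial orientation of $G$ is an orientation of a subset of the edges (a loop has two possible directions); a directed cut in it is the set of all edges between $X$ and $V(G)\setminus X$, for some nonempty proper subset $X$ of $V(G)$, provided that all of these edges are oriented from $X$ to $V(G)\setminus X$. A partial orientation is cut minimal (with respect to $(<,A)$) if in every directed cut the $<$-minimum edge is oriented in the same direction as in $A$. Let $p$ be a real number with $0<p<1/2$. Independently for each edge of $G$, orient the edge in each of its two directions with probability $p$ and leave it unoriented with probability $1-2p$. Then the probability that the resulting partial orientation is cut minimal equals $R(p)$. -/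

import Mathlib

open MeasureTheory
open scoped Graph

/-- `SignType` is a three-element discrete type, used below for the state of an edge. -/
instance : MeasurableSpace SignType := ⊤

namespace Graph

variable {α β : Type*}

/-! ### Connectivity, rank and the Tutte polynomial of a multigraph -/

/-- The simple graph on the vertices of `G` in which two distinct vertices are adjacent when some
edge of `S` joins them. It has the same connected components as the spanning subgraph `(V, S)`. -/
def spanningAdj (G : Graph α β) (S : Set E(G)) : SimpleGraph V(G) :=
  SimpleGraph.fromRel fun u v => ∃ e ∈ S, G.IsLink e u v

/-- `G` is connected (in particular it has a vertex). -/
def IsConnected (G : Graph α β) : Prop :=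
  (G.spanningAdj Set.univ).Connected

/-- The number of connected components of the spanning subgraph `(V, S)`. -/
noncomputable def numComponents (G : Graph α β) (S : Set E(G)) : ℕ :=
  Nat.card (G.spanningAdj S).ConnectedComponent

/-- The rank `r(S) = |V| - c(S)` of a set of edges in the cycle matroid of `G`. -/
noncomputable def edgeRank (G : Graph α β) (S : Set E(G)) : ℕ :=
  Nat.card V(G) - G.numComponents S

/-- The Tutte polynomial
`T(x, y) = ∑_{S ⊆ E} (x - 1)^(r(E) - r(S)) (y - 1)^(|S| - r(S))`,
with `x = X 0` and `y = X 1`. -/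
noncomputable def tuttePoly (G : Graph α β) [Fintype E(G)] : MvPolynomial (Fin 2) ℤ :=
  ∑ S : Finset E(G),
    (MvPolynomial.X 0 - 1) ^ (G.edgeRank Set.univ - G.edgeRank S) *
      (MvPolynomial.X 1 - 1) ^ (S.card - G.edgeRank S)

/-- The genus `g = m - n + 1` of a connected graph. -/
noncomputable def genus (G : Graph α β) : ℕ :=
  Nat.card E(G) + 1 - Nat.card V(G)

/-- The reliability polynomial `R(p) = (1 - p)^(n - 1) p^g T(1, 1 / p)`. -/
noncomputable def reliability (G : Graph α β) [Fintype E(G)] (p : ℝ) : ℝ :=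
  (1 - p) ^ (Nat.card V(G) - 1) * p ^ G.genus *
    MvPolynomial.aeval ![1, 1 / p] G.tuttePoly

/-! ### Partial orientations and cut minimality -/

/-- A full orientation of `G`: every edge, with ends `u` and `v`, gets one of its two ends as tail
and the other one as head (both ends of a loop coincide). -/
structure FullOrientation (G : Graph α β) where
  tail : E(G) → α
  head : E(G) → α
  isLink : ∀ e : E(G), G.IsLink e (tail e) (head e)

/-- A partial orientation of `G`, written relative to a reference full orientation `A`:
the value at `e` is `1` if `e` is oriented in the same direction as in `A`, `-1` if `e` is oriented
in the opposite direction, and `0` if `e` is unoriented. In this way a loop, too, has two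
opposite directions. -/
abbrev PartialOrientation (G : Graph α β) : Type _ := E(G) → SignType

/-- The edges of the cut between the vertex set `X` and its complement. -/
def cut (G : Graph α β) (X : Set α) : Set E(G) :=
  {e | ∃ u ∈ X, ∃ v ∈ V(G) \ X, G.IsLink e u v}

namespace FullOrientation

variable {G : Graph α β}

/-- In the partial orientation `O` (relative to `A`), the edge `e` is oriented from `u` to `v`. -/
def OrientedFromTo (A : G.FullOrientation) (O : G.PartialOrientation) (e : E(G)) (u v : α) :
    Prop :=
  (O e = 1 ∧ A.tail e = u ∧ A.head e = v) ∨ (O e = -1 ∧ A.head e = u ∧ A.tail e = v)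

/-- `C` is a directed cut of `O`: it is the set of edges between `X` and its complement, for some
nonempty proper set `X` of vertices, and `O` orients all of them from `X` to the complement. -/
def IsDirectedCut (A : G.FullOrientation) (O : G.PartialOrientation) (C : Set E(G)) : Prop :=
  ∃ X : Set α, X ⊆ V(G) ∧ X.Nonempty ∧ (V(G) \ X).Nonempty ∧ C = G.cut X ∧
    ∀ e ∈ C, ∃ u ∈ X, ∃ v ∈ V(G) \ X, A.OrientedFromTo O e u v

/-- `O` is cut minimal with respect to the total order on the edges and the reference orientation
`A`: in every directed cut of `O` the minimum edge is oriented in the same direction as in `A`. -/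
def IsCutMinimal [LinearOrder E(G)] (A : G.FullOrientation) (O : G.PartialOrientation) : Prop :=
  ∀ C : Set E(G), A.IsDirectedCut O C → ∀ e : E(G), IsLeast C e → O e = 1

end FullOrientation

/-! ### The random partial orientation -/

/-- The law of the state of one edge: each direction has probability `p`, unoriented has
probability `1 - 2 p`. -/
noncomputable def edgeLaw (p : ℝ) : Measure SignType :=
  ENNReal.ofReal p • Measure.dirac 1 + ENNReal.ofReal p • Measure.dirac (-1) +
    ENNReal.ofReal (1 - 2 * p) • Measure.dirac 0

/-- The law of the random partial orientation in which the states of the edges are independent and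
each of them has law `edgeLaw p`. -/
noncomputable def randomPartialOrientation (G : Graph α β) [Fintype E(G)] (p : ℝ) :
    Measure G.PartialOrientation :=
  Measure.pi fun _ => edgeLaw p

end Graph

namespace CutMinimal

variable {V E : Type*}

/-! The proof exchanges the random model one edge at a time. Edges may also be deleted (`none`), and
`Good` extends cut minimality to such states. Processing the edges from greatest to least, the law
(`p`, `p`, `1 - 2p`) on (forward, reversed, unoriented) is replaced by (`1 - p`, `p`) on
(unoriented, deleted). Writing [s] for the indicator of goodness when the edge `e` has state s, one
exchange preserves the probability because [1] + [-1] = [0] + [none] whenever no edge above `e` is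
oriented (`indicator_good_add`).

This identity says that [0] is the "or", and [none] the "and", of [1] and [-1]. Its substantial half
is `Good.update_one_or_neg_one`: two bad cuts, one for each direction of `e`, uncross to a bad cut
that avoids `e`.

After all exchanges each edge survives with probability `1 - p`, and a state is good exactly when
the survivors connect the graph (`good_unoriented_iff`). The resulting sum over connected spanning
edge sets is the reliability polynomial (`reliability_eq_sum`). -/

/-- Some edge across `X` is unoriented or oriented into `X`. An edge state `none` stands for a
deleted edge. -/
def Blocked (t h : E → V) (σ : E → Option SignType) (X : Set V) : Prop :=
  ∃ f, (t f ∈ X ∧ h f ∉ X ∧ (σ f = some 0 ∨ σ f = some (-1))) ∨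
    (h f ∈ X ∧ t f ∉ X ∧ (σ f = some 0 ∨ σ f = some 1))

/-- The cut of `X` is not directed, or its least edge is oriented as in the reference orientation;
a directed cut without edges does not qualify. -/
def GoodCut [LT E] (t h : E → V) (σ : E → Option SignType) (X : Set V) : Prop :=
  Blocked t h σ X ∨ ∃ f, t f ∈ X ∧ h f ∉ X ∧ σ f = some 1 ∧
    ∀ f', h f' ∈ X → t f' ∉ X → σ f' = some (-1) → f < f'

/-- Every cut is good. -/
def Good [LT E] (t h : E → V) (σ : E → Option SignType) : Prop :=
  ∀ X : Set V, X.Nonempty → Xᶜ.Nonempty → GoodCut t h σ X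

theorem GoodCut.of_eqOn_crossing [LT E] {t h : E → V} {σ τ : E → Option SignType} {X : Set V}
    (H : ∀ f, ¬(t f ∈ X ↔ h f ∈ X) → σ f = τ f) (hσ : GoodCut t h σ X) : GoodCut t h τ X := by
  rcases hσ with ⟨f, hf⟩ | ⟨f, h1, h2, h3, h4⟩
  · left
    refine ⟨f, ?_⟩
    rw [← H f (by tauto)]
    exact hf
  · right
    refine ⟨f, h1, h2, by rw [← H f (by tauto)]; exact h3, fun f' a b c => h4 f' a b ?_⟩
    rw [H f' (by tauto)]
    exact c

/-! ### Dependence of goodness on the state of one edge -/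

variable [LinearOrder E] {t h : E → V} {σ : E → Option SignType} {e : E}

theorem GoodCut.update_of_not_crossing {X : Set V} {s s' : Option SignType}
    (hX : t e ∈ X ↔ h e ∈ X) (H : GoodCut t h (Function.update σ e s) X) :
    GoodCut t h (Function.update σ e s') X := by
  refine H.of_eqOn_crossing fun f hf => ?_
  have : f ≠ e := by rintro rfl; exact hf hX
  simp [this]

theorem Good.update_zero {s : Option SignType} (H : Good t h (Function.update σ e s)) :
    Good t h (Function.update σ e (some 0)) := by
  intro X hX hX'
  by_cases hc : t e ∈ X ↔ h e ∈ X
  · exact (H X hX hX').update_of_not_crossing hc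
  · left
    refine ⟨e, ?_⟩
    simp only [Function.update_self]
    tauto

/-- A forward witness of a good cut is oriented, hence lies below `e`, so it still wins if `e` is
added to the cut as a reversed edge. -/
theorem Good.update_some (hσ : ∀ i, e < i → σ i = none ∨ σ i = some 0)
    (H : Good t h (Function.update σ e none)) (s : SignType) :
    Good t h (Function.update σ e (some s)) := by
  intro X hX hX'
  rcases H X hX hX' with ⟨f, hf⟩ | ⟨f, h1, h2, h3, h4⟩
  · left
    have : f ≠ e := by rintro rfl; simp at hf
    exact ⟨f, by simpa [this] using hf⟩
  · have hfe : f ≠ e := by rintro rfl; simp at h3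
    have hlt : f < e := by
      rcases lt_or_gt_of_ne hfe with h | h
      · exact h
      · rcases hσ f h with h' | h' <;> simp [hfe, h'] at h3
    right
    refine ⟨f, h1, h2, by simpa [hfe] using h3, fun f' a b c => ?_⟩
    by_cases hf' : f' = e
    · exact hf' ▸ hlt
    · exact h4 f' a b (by simpa [hf'] using c)

theorem Good.update_none (hσ : ∀ i, e < i → σ i = none ∨ σ i = some 0)
    (H1 : Good t h (Function.update σ e (some 1)))
    (H2 : Good t h (Function.update σ e (some (-1)))) :
    Good t h (Function.update σ e none) := by
  intro X hX hX'
  by_cases hc : t e ∈ X ↔ h e ∈ X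
  · exact (H1 X hX hX').update_of_not_crossing hc
  by_cases hte : t e ∈ X
  · have hhe : h e ∉ X := by tauto
    rcases H1 X hX hX' with ⟨f, hf⟩ | ⟨f, h1, h2, h3, h4⟩
    · left
      have hfe : f ≠ e := by rintro rfl; simp [hte, hhe] at hf
      exact ⟨f, by simpa [hfe] using hf⟩
    · by_cases hfe : f = e
      · subst hfe
        -- As `e` itself is the witness, a reversed edge in the cut would lie above `e`, where
        -- nothing is oriented.
        have hno : ∀ f', h f' ∈ X → t f' ∉ X → σ f' ≠ some (-1) := by
          intro f' a b c
          have hne : f' ≠ f := by rintro rfl; exact b hte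
          have := h4 f' a b (by simpa [hne] using c)
          rcases hσ f' this with h' | h' <;> simp [h'] at c
        -- With `e` reversed, the complementary cut is good through some other edge; that edge
        -- either blocks `X` or is a forward witness for `X`.
        rcases H2 Xᶜ hX' (by simpa using hX) with ⟨g, hg⟩ | ⟨g, g1, g2, g3, g4⟩
        · have hge : g ≠ f := by
            rintro rfl
            simp [hte, hhe] at hg
          simp only [Set.mem_compl_iff, not_not, Function.update_of_ne hge] at hg
          rcases hg with ⟨a, b, c | c⟩ | ⟨a, b, c | c⟩
          · exact Or.inl ⟨g, by simp [hge, a, b, c]⟩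
          · exact absurd c (hno g b a)
          · exact Or.inl ⟨g, by simp [hge, a, b, c]⟩
          · right
            refine ⟨g, b, a, by simp [hge, c], fun f' a' b' c' => ?_⟩
            have hne : f' ≠ f := by rintro rfl; exact b' hte
            exact absurd (by simpa [hne] using c') (hno f' a' b')
        · have hge : g ≠ f := by
            rintro rfl
            exact g1 hte
          simp only [Set.mem_compl_iff, not_not, Function.update_of_ne hge] at g1 g2 g3
          exact Or.inl ⟨g, by simp [hge, g1, g2, g3]⟩
      · right
        refine ⟨f, h1, h2, by simpa [hfe] using h3, fun f' a b c => h4 f' a b ?_⟩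
        have hne : f' ≠ e := by rintro rfl; exact b hte
        simpa [hne] using c
  · have hhe : h e ∈ X := by tauto
    rcases H2 X hX hX' with ⟨f, hf⟩ | ⟨f, h1, h2, h3, h4⟩
    · left
      have hfe : f ≠ e := by rintro rfl; simp [hte, hhe] at hf
      exact ⟨f, by simpa [hfe] using hf⟩
    · right
      have hfe : f ≠ e := by rintro rfl; exact hte h1
      refine ⟨f, h1, h2, by simpa [hfe] using h3, fun f' a b c => h4 f' a b ?_⟩
      have hne : f' ≠ e := by rintro rfl; simp at c
      simpa [hne] using c

theorem eq_none_or_one_of_not_blocked {s : Option SignType} {X : Set V} {f : E}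
    (H : ¬ Blocked t h (Function.update σ e s) X) (hf : f ≠ e) (a : t f ∈ X) (b : h f ∉ X) :
    σ f = none ∨ σ f = some 1 := by
  by_contra hn
  refine H ⟨f, Or.inl ⟨a, b, ?_⟩⟩
  rw [Function.update_of_ne hf]
  revert hn; rcases σ f with _ | s <;> [simp; (cases s <;> decide)]

theorem eq_none_or_neg_one_of_not_blocked {s : Option SignType} {X : Set V} {f : E}
    (H : ¬ Blocked t h (Function.update σ e s) X) (hf : f ≠ e) (a : h f ∈ X) (b : t f ∉ X) :
    σ f = none ∨ σ f = some (-1) := by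
  by_contra hn
  refine H ⟨f, Or.inr ⟨a, b, ?_⟩⟩
  rw [Function.update_of_ne hf]
  revert hn; rcases σ f with _ | s <;> [simp; (cases s <;> decide)]

/-- Uncrossing: if `X` is bad for `e` forward and `Y` for `e` reversed, then `e` runs between `X \
Y` and `Y \ X`, so it crosses neither `X ∩ Y` nor `X ∪ Y`. One of these two cuts is bad whatever the
state of `e`. -/
theorem Good.update_one_or_neg_one [Finite E] (hσ : ∀ i, e < i → σ i = none ∨ σ i = some 0)
    (H0 : Good t h (Function.update σ e (some 0))) :
    Good t h (Function.update σ e (some 1)) ∨ Good t h (Function.update σ e (some (-1))) := by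
  by_contra! hcon
  obtain ⟨N1, N2⟩ := hcon
  simp only [Good, not_forall] at N1 N2
  obtain ⟨X, hX, hX', BX⟩ := N1
  obtain ⟨Y, hY, hY', BY⟩ := N2
  have cX : ¬ (t e ∈ X ↔ h e ∈ X) := fun hc => BX ((H0 X hX hX').update_of_not_crossing hc)
  have cY : ¬ (t e ∈ Y ↔ h e ∈ Y) := fun hc => BY ((H0 Y hY hY').update_of_not_crossing hc)
  simp only [GoodCut, not_or, not_exists, not_and, not_forall] at BX BY
  obtain ⟨bX, mX⟩ := BX
  obtain ⟨bY, mY⟩ := BY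
  have teX : t e ∈ X := by
    by_contra hn
    exact bX ⟨e, Or.inr ⟨by tauto, hn, by simp⟩⟩
  have heX : h e ∉ X := by tauto
  have heY : h e ∈ Y := by
    by_contra hn
    exact bY ⟨e, Or.inl ⟨by tauto, hn, by simp⟩⟩
  have teY : t e ∉ Y := by tauto
  have oX := fun f => eq_none_or_one_of_not_blocked (f := f) bX
  have iX := fun f => eq_none_or_neg_one_of_not_blocked (f := f) bX
  have oY := fun f => eq_none_or_one_of_not_blocked (f := f) bY
  have iY := fun f => eq_none_or_neg_one_of_not_blocked (f := f) bY
  let D : Set E := {f | f ≠ e ∧ σ f ≠ none ∧ (¬ (t f ∈ X ↔ h f ∈ X) ∨ ¬ (t f ∈ Y ↔ h f ∈ Y))}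
  have hD : D.Nonempty := by
    obtain ⟨f, a, b, c, -⟩ := mX e teX heX (by simp)
    have hne : f ≠ e := by rintro rfl; exact b teX
    rw [Function.update_of_ne hne] at c
    exact ⟨f, hne, by simp [c], Or.inl fun k => b (k.2 a)⟩
  obtain ⟨f, hfD, hmin⟩ := (Set.toFinite D).exists_minimal hD
  replace hmin : ∀ f' ∈ D, f ≤ f' := fun f' hf' => by
    rcases le_total f f' with hle | hle
    · exact hle
    · exact hmin hf' hle
  obtain ⟨hfe, hfn, hcr⟩ := hfD
  -- In a bad cut every forward edge is preceded by a reversed one, so the least edge of `D` is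
  -- reversed. For `Y` the preceding edge could be `e`, but then `f` would lie above `e` and be
  -- unoriented or deleted.
  have hfneg : σ f = some (-1) ∧ ((h f ∈ X ∧ t f ∉ X) ∨ (h f ∈ Y ∧ t f ∉ Y)) := by
    by_cases hcX : t f ∈ X ↔ h f ∈ X
    · have hcY := hcr.resolve_left (not_not.2 hcX)
      by_cases htY : t f ∈ Y
      · have hh : h f ∉ Y := fun d => hcY ⟨fun _ => d, fun _ => htY⟩
        have h1 : σ f = some 1 := (oY f hfe htY hh).resolve_left hfn
        obtain ⟨f', a, b, c, d⟩ := mY f htY hh (by simpa [hfe] using h1)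
        have hlt : f' < f := by
          refine lt_of_le_of_ne (not_lt.1 d) ?_
          rintro rfl
          exact b htY
        by_cases hfe' : f' = e
        · subst hfe'
          rcases hσ f hlt with h' | h' <;> simp [h'] at h1
        · rw [Function.update_of_ne hfe'] at c
          exact absurd (hmin f' ⟨hfe', by simp [c], Or.inr fun k => b (k.2 a)⟩) (not_le.2 hlt)
      · have : h f ∈ Y := by
          by_contra d
          exact hcY ⟨fun c => absurd c htY, fun c => absurd c d⟩
        exact ⟨(iY f hfe this htY).resolve_left hfn, Or.inr ⟨this, htY⟩⟩
    · by_cases htX : t f ∈ X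
      · have hh : h f ∉ X := fun d => hcX ⟨fun _ => d, fun _ => htX⟩
        have h1 : σ f = some 1 := (oX f hfe htX hh).resolve_left hfn
        obtain ⟨f', a, b, c, d⟩ := mX f htX hh (by simpa [hfe] using h1)
        have hlt : f' < f := by
          refine lt_of_le_of_ne (not_lt.1 d) ?_
          rintro rfl
          exact b htX
        have hfe' : f' ≠ e := by rintro rfl; exact b teX
        rw [Function.update_of_ne hfe'] at c
        exact absurd (hmin f' ⟨hfe', by simp [c], Or.inl fun k => b (k.2 a)⟩) (not_le.2 hlt)
      · have : h f ∈ X := by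
          by_contra d
          exact hcX ⟨fun c => absurd c htX, fun c => absurd c d⟩
        exact ⟨(iX f hfe this htX).resolve_left hfn, Or.inl ⟨this, htX⟩⟩
  obtain ⟨hf1, hf2⟩ := hfneg
  -- If all edges across `Z` cross `X` or `Y` in the same sense, then `Z` is directed with reversed
  -- least edge `f`, contradicting `H0`.
  have key : ∀ Z : Set V, (t e ∈ Z ↔ h e ∈ Z) → h f ∈ Z → t f ∉ Z →
      (∀ g, t g ∈ Z → h g ∉ Z → (t g ∈ X ∧ h g ∉ X) ∨ (t g ∈ Y ∧ h g ∉ Y)) →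
      (∀ g, h g ∈ Z → t g ∉ Z → (h g ∈ X ∧ t g ∉ X) ∨ (h g ∈ Y ∧ t g ∉ Y)) → False := by
    intro Z ceZ hfZ tfZ hout hin
    have out1 : ∀ g, g ≠ e → t g ∈ Z → h g ∉ Z → σ g = none ∨ σ g = some 1 := fun g hg a b =>
      (hout g a b).elim (fun c => oX g hg c.1 c.2) (fun c => oY g hg c.1 c.2)
    have in1 : ∀ g, g ≠ e → h g ∈ Z → t g ∉ Z → σ g = none ∨ σ g = some (-1) := fun g hg a b =>
      (hin g a b).elim (fun c => iX g hg c.1 c.2) (fun c => iY g hg c.1 c.2)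
    rcases H0 Z ⟨_, hfZ⟩ ⟨_, tfZ⟩ with ⟨g, ⟨a, b, c⟩ | ⟨a, b, c⟩⟩ | ⟨g, a, b, c, d⟩
    · have hg : g ≠ e := fun hg => b (hg ▸ ceZ.1 (hg ▸ a))
      rw [Function.update_of_ne hg] at c
      rcases out1 g hg a b with h' | h' <;> simp [h'] at c
    · have hg : g ≠ e := fun hg => b (hg ▸ ceZ.2 (hg ▸ a))
      rw [Function.update_of_ne hg] at c
      rcases in1 g hg a b with h' | h' <;> simp [h'] at c
    · have hg : g ≠ e := fun hg => b (hg ▸ ceZ.1 (hg ▸ a))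
      rw [Function.update_of_ne hg] at c
      have hlt := d f hfZ tfZ (by simpa [hfe] using hf1)
      exact absurd (hmin g ⟨hg, by simp [c], (hout g a b).imp (fun c d => c.2 (d.1 c.1))
        fun c d => c.2 (d.1 c.1)⟩) (not_le.2 hlt)
  have nX : t f ∈ X → h f ∈ X := fun a => by
    by_contra b
    rcases oX f hfe a b with h' | h' <;> simp [h'] at hf1
  have nY : t f ∈ Y → h f ∈ Y := fun a => by
    by_contra b
    rcases oY f hfe a b with h' | h' <;> simp [h'] at hf1
  -- The position of the tail of `f` decides which of `X ∩ Y` and `X ∪ Y` is crossed by `f`.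
  by_cases hu : t f ∈ X ∪ Y
  · refine key (X ∩ Y) ⟨fun c => absurd c.2 teY, fun c => absurd c.1 heX⟩ ?_ ?_
      (fun g a b => ?_) fun g a b => ?_
    · rcases hf2 with c | c
      · exact ⟨c.1, nY (hu.resolve_left c.2)⟩
      · exact ⟨nX (hu.resolve_right c.2), c.1⟩
    · exact fun d => hf2.elim (fun c => c.2 d.1) fun c => c.2 d.2
    · by_cases hg : h g ∈ X
      · exact Or.inr ⟨a.2, fun d => b ⟨hg, d⟩⟩
      · exact Or.inl ⟨a.1, hg⟩
    · by_cases hg : t g ∈ X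
      · exact Or.inr ⟨a.2, fun d => b ⟨hg, d⟩⟩
      · exact Or.inl ⟨a.1, hg⟩
  · refine key (X ∪ Y) ⟨fun _ => Or.inr heY, fun _ => Or.inl teX⟩
      (hf2.imp And.left And.left) hu (fun g a b => ?_) fun g a b => ?_
    · exact a.imp (fun c => ⟨c, fun d => b (Or.inl d)⟩) fun c => ⟨c, fun d => b (Or.inr d)⟩
    · exact a.imp (fun c => ⟨c, fun d => b (Or.inl d)⟩) fun c => ⟨c, fun d => b (Or.inr d)⟩

-- The four implications between the indicators leave only the patterns in which both sides agree.
open Classical in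
theorem indicator_good_add [Finite E] (hσ : ∀ i, e < i → σ i = none ∨ σ i = some 0) :
    ((if Good t h (Function.update σ e (some 1)) then 1 else 0 : ℝ) +
      if Good t h (Function.update σ e (some (-1))) then 1 else 0) =
    (if Good t h (Function.update σ e (some 0)) then 1 else 0) +
      if Good t h (Function.update σ e none) then 1 else 0 := by
  have a1 := fun H : Good t h (Function.update σ e none) => H.update_some hσ 1
  have a2 := fun H : Good t h (Function.update σ e none) => H.update_some hσ (-1)
  have a3 := fun H : Good t h (Function.update σ e (some 1)) => H.update_zero
  have a4 := fun H : Good t h (Function.update σ e (some (-1))) => H.update_zero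
  have a5 := fun H1 H2 => Good.update_none (t := t) (h := h) hσ H1 H2
  have a6 := fun H0 => Good.update_one_or_neg_one (t := t) (h := h) hσ H0
  by_cases b1 : Good t h (Function.update σ e (some 1)) <;>
  by_cases b2 : Good t h (Function.update σ e (some (-1))) <;>
  by_cases b3 : Good t h (Function.update σ e (some 0)) <;>
  by_cases b4 : Good t h (Function.update σ e none) <;>
  simp only [b1, b2, b3, b4, if_true, if_false] <;> first | (norm_num; done) | (exfalso; tauto)

/-! ### Weighted sums over edge states -/

/-- Each direction has weight `p`, and an edge is unoriented with weight `1 - 2 p`. -/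
def orientWeight (p : ℝ) : Option SignType → ℝ
  | none => 0
  | some s => if s = 0 then 1 - 2 * p else p

/-- An edge is unoriented with weight `1 - p` and deleted with weight `p`. -/
def deleteWeight (p : ℝ) : Option SignType → ℝ
  | none => p
  | some s => if s = 0 then 1 - p else 0

/-- Fubini in the coordinate `i`. The one-coordinate identity is needed only where the other weights
do not vanish, which lets it rely on the support of weights already exchanged. -/
theorem sum_prod_mul_congr_weight {ι S : Type*} [Fintype ι] [DecidableEq ι] [Fintype S]
    (w w' : ι → S → ℝ) (f : (ι → S) → ℝ) (i : ι) (hw : ∀ j, j ≠ i → w j = w' j)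
    (H : ∀ σ : ι → S, (∀ j, j ≠ i → w j (σ j) ≠ 0) →
      ∑ s, w i s * f (Function.update σ i s) = ∑ s, w' i s * f (Function.update σ i s)) :
    ∑ σ : ι → S, (∏ j, w j (σ j)) * f σ = ∑ σ : ι → S, (∏ j, w' j (σ j)) * f σ := by
  have split : ∀ v : ι → S → ℝ, ∑ σ : ι → S, (∏ j, v j (σ j)) * f σ =
      ∑ τ : {j // j ≠ i} → S, (∏ j, v j.1 (τ j)) *
        ∑ s, v i s * f ((Equiv.funSplitAt i S).symm (s, τ)) := by
    intro v
    rw [← (Equiv.funSplitAt i S).symm.sum_comp, Fintype.sum_prod_type_right]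
    refine Finset.sum_congr rfl fun τ _ => ?_
    rw [Finset.mul_sum]
    refine Finset.sum_congr rfl fun s _ => ?_
    rw [Fintype.prod_eq_mul_prod_subtype_ne _ i]
    have h1 : (Equiv.funSplitAt i S).symm (s, τ) i = s := by simp
    have h2 : ∀ j : {j // j ≠ i}, (Equiv.funSplitAt i S).symm (s, τ) j.1 = τ j := fun j => by
      simp [j.2]
    simp only [h1, h2]
    ring
  rw [split, split]
  refine Finset.sum_congr rfl fun τ _ => ?_
  have e1 : ∏ j : {j // j ≠ i}, w j.1 (τ j) = ∏ j : {j // j ≠ i}, w' j.1 (τ j) :=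
    Finset.prod_congr rfl fun j _ => by rw [hw j.1 j.2]
  rw [← e1]
  by_cases h0 : ∏ j : {j // j ≠ i}, w j.1 (τ j) = 0
  · simp [h0]
  congr 1
  rcases isEmpty_or_nonempty S with hS | ⟨⟨s₀⟩⟩
  · simp
  have e2 : ∀ s, (Equiv.funSplitAt i S).symm (s, τ) =
      Function.update ((Equiv.funSplitAt i S).symm (s₀, τ)) i s := by
    intro s
    ext j
    by_cases hj : j = i
    · subst hj; simp
    · simp [hj]
  have e3 : ∀ v : S → ℝ, ∑ s, v s * f ((Equiv.funSplitAt i S).symm (s, τ)) =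
      ∑ s, v s * f (Function.update ((Equiv.funSplitAt i S).symm (s₀, τ)) i s) :=
    fun v => Finset.sum_congr rfl fun s _ => by rw [e2 s]
  rw [e3, e3]
  refine H _ fun j hj => ?_
  have := Finset.prod_ne_zero_iff.1 h0 ⟨j, hj⟩ (Finset.mem_univ _)
  simpa [hj] using this

open Classical in
theorem sum_orientWeight_eq_sum_deleteWeight [Fintype E] (t h : E → V) (p : ℝ) :
    ∑ σ : E → Option SignType, (∏ e, orientWeight p (σ e)) * (if Good t h σ then 1 else 0) =
    ∑ σ : E → Option SignType, (∏ e, deleteWeight p (σ e)) * (if Good t h σ then 1 else 0) := by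
  -- The exchanged edges form an upper set, so when `a` is exchanged every edge above it already
  -- carries `deleteWeight`, whose support is {`none`, `some 0`}.
  have key : ∀ s : Finset E, IsUpperSet (s : Set E) →
      ∑ σ : E → Option SignType, (∏ e, orientWeight p (σ e)) * (if Good t h σ then 1 else 0) =
      ∑ σ : E → Option SignType,
        (∏ e, (if e ∈ s then deleteWeight p else orientWeight p) (σ e)) *
          (if Good t h σ then 1 else 0) := by
    intro s
    induction s using Finset.induction_on_min with
    | empty => simp
    | insert a s ha ih =>
      intro hup
      have has : a ∉ s := fun hmem => lt_irrefl _ (ha a hmem)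
      have hs : IsUpperSet (s : Set E) := by
        intro x y hxy hx
        have hy : y ∈ insert a s := by
          have := hup hxy (show x ∈ ((insert a s : Finset E) : Set E) by
            simp only [Finset.coe_insert, Set.mem_insert_iff]; exact Or.inr hx)
          simpa using this
        rcases Finset.mem_insert.1 hy with rfl | hy
        · exact absurd (ha x hx) (not_lt.2 hxy)
        · exact hy
      rw [ih hs]
      refine sum_prod_mul_congr_weight
        (fun e => if e ∈ s then deleteWeight p else orientWeight p)
        (fun e => if e ∈ insert a s then deleteWeight p else orientWeight p) _ a
        (fun j hj => by simp [hj]) fun σ hσ => ?_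
      have hσ' : ∀ i, a < i → σ i = none ∨ σ i = some 0 := by
        intro i hi
        have his : i ∈ s := by
          have : i ∈ ((insert a s : Finset E) : Set E) := hup hi.le (by simp)
          simpa [hi.ne'] using this
        have := hσ i hi.ne'
        rw [if_pos his] at this
        revert this
        rcases σ i with _ | x
        · simp
        · by_cases hx : x = 0 <;> simp [deleteWeight, hx]
      have := indicator_good_add (t := t) (h := h) hσ'
      have hsum : ∀ F : Option SignType → ℝ,
          ∑ x, F x = F none + (F (some 0) + F (some (-1)) + F (some 1)) := by
        intro F
        rw [Fintype.sum_option]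
        congr 1
        rw [show (Finset.univ : Finset SignType) = {0, -1, 1} from rfl]
        rw [Finset.sum_insert (by decide), Finset.sum_insert (by decide), Finset.sum_singleton]
        ring
      simp only [has, if_false, Finset.mem_insert_self, if_true, hsum]
      simp only [orientWeight, deleteWeight, if_true, if_neg (show (1 : SignType) ≠ 0 by decide),
        if_neg (show (-1 : SignType) ≠ 0 by decide)]
      -- The two weights differ by `p` times the coefficients of the indicator identity.
      linear_combination p * this
  simpa using key Finset.univ (by simpa using isUpperSet_univ)

end CutMinimal

namespace Graph

open CutMinimal

variable {α β : Type*} {G : Graph α β}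

/-! ### The law of the random partial orientation -/

instance (p : ℝ) : IsFiniteMeasure (edgeLaw p) := by
  refine ⟨?_⟩
  simp only [edgeLaw, Measure.add_apply, Measure.smul_apply, smul_eq_mul, measure_univ, mul_one]
  exact ENNReal.add_lt_top.2 ⟨ENNReal.add_lt_top.2 ⟨ENNReal.ofReal_lt_top, ENNReal.ofReal_lt_top⟩,
    ENNReal.ofReal_lt_top⟩

theorem edgeLaw_real_singleton {p : ℝ} (hp0 : 0 < p) (hp : p < 1 / 2) (s : SignType) :
    (edgeLaw p).real {s} = orientWeight p (some s) := by
  have h1 : 0 ≤ 1 - 2 * p := by linarith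
  cases s <;> simp [edgeLaw, orientWeight, measureReal_def, hp0.le, h1]

instance [Fintype E(G)] (p : ℝ) : IsFiniteMeasure (G.randomPartialOrientation p) := by
  unfold randomPartialOrientation
  infer_instance

theorem randomPartialOrientation_real_singleton [Fintype E(G)] {p : ℝ} (hp0 : 0 < p)
    (hp : p < 1 / 2) (O : G.PartialOrientation) :
    (G.randomPartialOrientation p).real {O} = ∏ e, orientWeight p (some (O e)) := by
  rw [measureReal_def, randomPartialOrientation, ← Set.univ_pi_singleton, Measure.pi_pi,
    ENNReal.toReal_prod]
  exact Finset.prod_congr rfl fun e _ => edgeLaw_real_singleton hp0 hp (O e)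

open Classical in
theorem randomPartialOrientation_real [Fintype E(G)] {p : ℝ} (hp0 : 0 < p) (hp : p < 1 / 2)
    (P : Set G.PartialOrientation) :
    (G.randomPartialOrientation p).real P =
      ∑ O : G.PartialOrientation, (∏ e, orientWeight p (some (O e))) *
        (if O ∈ P then 1 else 0) := by
  rw [← Set.coe_toFinset P, ← sum_measureReal_singleton]
  simp only [randomPartialOrientation_real_singleton hp0 hp, mul_ite, mul_one, mul_zero,
    Set.coe_toFinset]
  rw [← Finset.sum_filter]
  congr 1
  ext O
  simp

/-! ### Connectivity and cuts -/

namespace FullOrientation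

/-- The tail of an edge as an element of the vertex set. -/
def tailVertex (A : G.FullOrientation) (e : E(G)) : V(G) := ⟨A.tail e, (A.isLink e).left_mem⟩

/-- The head of an edge as an element of the vertex set. -/
def headVertex (A : G.FullOrientation) (e : E(G)) : V(G) := ⟨A.head e, (A.isLink e).right_mem⟩

end FullOrientation

theorem spanningAdj_reachable (A : G.FullOrientation) {S : Set E(G)} {e : E(G)} (he : e ∈ S) :
    (G.spanningAdj S).Reachable (A.tailVertex e) (A.headVertex e) := by
  by_cases hne : A.tailVertex e = A.headVertex e
  · rw [hne]
  · exact SimpleGraph.Adj.reachable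
      ((SimpleGraph.fromRel_adj _ _ _).2 ⟨hne, Or.inl ⟨e, he, A.isLink e⟩⟩)

theorem spanningAdj_adj (A : G.FullOrientation) {S : Set E(G)} {u v : V(G)}
    (h : (G.spanningAdj S).Adj u v) :
    ∃ e ∈ S, (A.tailVertex e = u ∧ A.headVertex e = v) ∨
      (A.tailVertex e = v ∧ A.headVertex e = u) := by
  obtain ⟨-, ⟨e, he, hl⟩ | ⟨e, he, hl⟩⟩ := (SimpleGraph.fromRel_adj _ _ _).1 h
  · exact ⟨e, he, by
      simpa [FullOrientation.tailVertex, FullOrientation.headVertex, Subtype.ext_iff] using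
        (A.isLink e).eq_and_eq_or_eq_and_eq hl⟩
  · exact ⟨e, he, by
      simpa [FullOrientation.tailVertex, FullOrientation.headVertex, Subtype.ext_iff] using
        (A.isLink e).eq_and_eq_or_eq_and_eq hl.symm⟩

theorem spanningAdj_preconnected_iff (A : G.FullOrientation) (S : Set E(G)) :
    (G.spanningAdj S).Preconnected ↔ ∀ X : Set V(G), X.Nonempty → Xᶜ.Nonempty →
      ∃ e ∈ S, ¬ (A.tailVertex e ∈ X ↔ A.headVertex e ∈ X) := by
  constructor
  · rintro hpre X ⟨u, hu⟩ ⟨v, hv⟩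
    by_contra! hcon
    refine hv ?_
    obtain ⟨w⟩ := hpre u v
    induction w with
    | nil => exact hu
    | cons hadj _ ih =>
      obtain ⟨e, he, ⟨rfl, rfl⟩ | ⟨rfl, rfl⟩⟩ := spanningAdj_adj A hadj
      · exact ih ((hcon e he).1 hu) hv
      · exact ih ((hcon e he).2 hu) hv
  · intro H u v
    by_contra hn
    obtain ⟨e, he, hcr⟩ := H {w | (G.spanningAdj S).Reachable u w} ⟨u, .refl u⟩ ⟨v, hn⟩
    have := spanningAdj_reachable A he
    exact hcr ⟨fun h => h.trans this, fun h => h.trans this.symm⟩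

theorem numComponents_eq_one_iff [Nonempty V(G)] (S : Set E(G)) :
    G.numComponents S = 1 ↔ (G.spanningAdj S).Preconnected := by
  rw [numComponents, Nat.card_eq_one_iff_unique]
  constructor
  · rintro ⟨h, -⟩ u v
    exact SimpleGraph.ConnectedComponent.exact (h.elim _ _)
  · intro h
    exact ⟨h.subsingleton_connectedComponent, inferInstance⟩

/-- Choosing for each adjacency an edge of `S` that realizes it is injective, so the bound for
simple graphs transfers. It keeps the truncated subtractions in the genus and in the exponents
honest. -/
theorem card_vertexSet_le_of_preconnected [Fintype E(G)] (S : Finset E(G))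
    (h : (G.spanningAdj S).Preconnected) : Nat.card V(G) ≤ S.card + 1 := by
  rcases isEmpty_or_nonempty V(G) with hV | hV
  · simp
  have hc : (G.spanningAdj S).Connected := ⟨h⟩
  refine hc.card_vert_le_card_edgeSet_add_one.trans (Nat.add_le_add_right ?_ 1)
  have hex : ∀ d : (G.spanningAdj S).edgeSet, ∃ e : S, ∃ u v : V(G),
      d.1 = s(u, v) ∧ G.IsLink e.1 u v := by
    rintro ⟨d, hd⟩
    induction d using Sym2.ind with
    | _ u v =>
      obtain ⟨-, ⟨e, he, hl⟩ | ⟨e, he, hl⟩⟩ := (SimpleGraph.fromRel_adj _ _ _).1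
        ((SimpleGraph.mem_edgeSet _).1 hd)
      · exact ⟨⟨e, he⟩, u, v, rfl, hl⟩
      · exact ⟨⟨e, he⟩, u, v, rfl, hl.symm⟩
  choose φ hφ using hex
  have hinj : Function.Injective φ := by
    intro d d' hdd
    obtain ⟨u, v, h1, h2⟩ := hφ d
    obtain ⟨u', v', h1', h2'⟩ := hφ d'
    rw [← hdd] at h2'
    refine Subtype.ext ?_
    rw [h1, h1', Sym2.eq_iff]
    simpa [Subtype.ext_iff] using h2.eq_and_eq_or_eq_and_eq h2'
  simpa using Nat.card_le_card_of_injective φ hinj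

/-! ### The reliability polynomial -/

open Classical in
theorem reliability_eq_sum [Fintype V(G)] [Fintype E(G)] (hG : G.IsConnected) {p : ℝ}
    (hp0 : 0 < p) :
    G.reliability p = ∑ S : Finset E(G), (1 - p) ^ S.card * p ^ (Nat.card E(G) - S.card) *
      (if (G.spanningAdj S).Preconnected then 1 else 0) := by
  have : Nonempty V(G) := hG.nonempty
  have hn : 0 < Nat.card V(G) := Nat.card_pos
  have hE : G.edgeRank Set.univ = Nat.card V(G) - 1 := by
    rw [edgeRank, (numComponents_eq_one_iff _).2 hG.preconnected]
  have hm : Nat.card V(G) ≤ Nat.card E(G) + 1 := by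
    have := card_vertexSet_le_of_preconnected (G := G) Finset.univ
      (by simpa using hG.preconnected)
    simpa using this
  rw [reliability, tuttePoly, map_sum, Finset.mul_sum]
  refine Finset.sum_congr rfl fun S _ => ?_
  simp only [map_mul, map_pow, map_sub, MvPolynomial.aeval_X, map_one, Matrix.cons_val_zero,
    Matrix.cons_val_one, sub_self]
  by_cases hS : (G.spanningAdj S).Preconnected
  · have hr : G.edgeRank S = Nat.card V(G) - 1 := by
      rw [edgeRank, (numComponents_eq_one_iff _).2 hS]
    have hc := card_vertexSet_le_of_preconnected S hS
    rw [hE, hr, if_pos hS, Nat.sub_self, pow_zero, genus]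
    -- Here `k` is the nullity of `S`; with `l` edges outside `S`, the genus is `k + l`, and `p ^ k`
    -- cancels the denominator of `((1 - p) / p) ^ k`.
    obtain ⟨k, hk⟩ : ∃ k, S.card = Nat.card V(G) - 1 + k := ⟨S.card - (Nat.card V(G) - 1), by omega⟩
    have hcard : S.card ≤ Nat.card E(G) := by
      rw [Nat.card_eq_fintype_card]
      exact S.card_le_univ
    obtain ⟨l, hl⟩ := Nat.exists_eq_add_of_le hcard
    have hg : Nat.card E(G) + 1 - Nat.card V(G) = k + l := by omega
    rw [hg, hl, Nat.add_sub_cancel_left, hk, Nat.add_sub_cancel_left, show 1 / p - 1 = (1 - p) / p by field_simp, div_pow]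
    have : p ^ k ≠ 0 := pow_ne_zero _ hp0.ne'
    rw [pow_add, pow_add]
    field_simp
  · have hc1 : 1 < G.numComponents S := by
      have h1 : G.numComponents S ≠ 1 := fun h => hS ((numComponents_eq_one_iff _).1 h)
      have h0 : 0 < G.numComponents S := Nat.card_pos
      omega
    -- A disconnected `S` has a rank deficit, so its term contains a positive power of `x - 1 = 0`.
    have hne : G.edgeRank Set.univ - G.edgeRank S ≠ 0 := by
      have hle : G.numComponents S ≤ Nat.card V(G) :=
        Nat.card_le_card_of_surjective _ Quot.mk_surjective
      rw [hE, edgeRank]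
      omega
    rw [if_neg hS, zero_pow hne]
    ring

/-! ### Goodness in terms of connectivity and cut minimality -/

namespace FullOrientation

theorem mem_cut_image_iff (A : G.FullOrientation) (X : Set V(G)) (e : E(G)) :
    e ∈ G.cut (Subtype.val '' X) ↔ ¬ (A.tailVertex e ∈ X ↔ A.headVertex e ∈ X) := by
  constructor
  · rintro ⟨_, ⟨u, hu, rfl⟩, v, ⟨hv, hv'⟩, hl⟩ hc
    have hvX : (⟨v, hv⟩ : V(G)) ∉ X := fun h => hv' ⟨_, h, rfl⟩
    rcases (A.isLink e).eq_and_eq_or_eq_and_eq hl with ⟨h1, h2⟩ | ⟨h1, h2⟩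
    · have e1 : A.tailVertex e = u := Subtype.ext h1
      have e2 : A.headVertex e = ⟨v, hv⟩ := Subtype.ext h2
      rw [e1, e2] at hc
      exact hvX (hc.1 hu)
    · have e1 : A.tailVertex e = ⟨v, hv⟩ := Subtype.ext h1
      have e2 : A.headVertex e = u := Subtype.ext h2
      rw [e1, e2] at hc
      exact hvX (hc.2 hu)
  · intro hc
    have hval : ∀ w : V(G), w ∉ X → w.1 ∈ V(G) \ Subtype.val '' X := by
      rintro w hw
      refine ⟨w.2, ?_⟩
      rintro ⟨w', hw', h⟩
      exact hw (Subtype.ext h ▸ hw')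
    by_cases ht : A.tailVertex e ∈ X
    · exact ⟨_, ⟨_, ht, rfl⟩, _, hval (A.headVertex e) (by tauto), A.isLink e⟩
    · exact ⟨_, ⟨_, (by tauto : A.headVertex e ∈ X), rfl⟩, _, hval _ ht, (A.isLink e).symm⟩

theorem exists_orientedFromTo_iff (A : G.FullOrientation) (O : G.PartialOrientation)
    (X : Set V(G)) (e : E(G)) :
    (∃ u ∈ Subtype.val '' X, ∃ v ∈ V(G) \ Subtype.val '' X, A.OrientedFromTo O e u v) ↔
      (O e = 1 ∧ A.tailVertex e ∈ X ∧ A.headVertex e ∉ X) ∨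
      (O e = -1 ∧ A.headVertex e ∈ X ∧ A.tailVertex e ∉ X) := by
  have hmem : ∀ w : V(G), w.1 ∈ Subtype.val '' X ↔ w ∈ X := fun w =>
    Subtype.val_injective.mem_set_image
  constructor
  · rintro ⟨_, hu, _, ⟨-, hv⟩, ⟨h1, rfl, rfl⟩ | ⟨h1, rfl, rfl⟩⟩
    · exact Or.inl ⟨h1, (hmem (A.tailVertex e)).1 hu, fun h => hv ((hmem (A.headVertex e)).2 h)⟩
    · exact Or.inr ⟨h1, (hmem (A.headVertex e)).1 hu, fun h => hv ((hmem (A.tailVertex e)).2 h)⟩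
  · rintro (⟨h1, hu, hv⟩ | ⟨h1, hu, hv⟩)
    · exact ⟨_, (hmem _).2 hu, _, ⟨(A.headVertex e).2, fun h => hv ((hmem _).1 h)⟩,
        Or.inl ⟨h1, rfl, rfl⟩⟩
    · exact ⟨_, (hmem _).2 hu, _, ⟨(A.tailVertex e).2, fun h => hv ((hmem _).1 h)⟩,
        Or.inr ⟨h1, rfl, rfl⟩⟩

theorem forall_mem_cut_oriented_iff (A : G.FullOrientation) (O : G.PartialOrientation)
    (X : Set V(G)) :
    (∀ e ∈ G.cut (Subtype.val '' X), ∃ u ∈ Subtype.val '' X, ∃ v ∈ V(G) \ Subtype.val '' X,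
      A.OrientedFromTo O e u v) ↔
    ¬ Blocked A.tailVertex A.headVertex (fun e => some (O e)) X := by
  simp only [Blocked, not_exists, mem_cut_image_iff A, exists_orientedFromTo_iff,
    Option.some.injEq]
  refine forall_congr' fun e => ?_
  rcases O e with _ | _ | _ <;> simp <;> tauto

end FullOrientation

variable [LinearOrder E(G)]

/-- With nothing oriented, a cut can be good only by being blocked, that is, by containing an edge
of `S`. Empty cuts count as bad in `GoodCut` for this purpose. -/
theorem good_unoriented_iff (A : G.FullOrientation) (S : Finset E(G)) [∀ e, Decidable (e ∈ S)] :
    Good A.tailVertex A.headVertex (fun e => if e ∈ S then some 0 else none) ↔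
      (G.spanningAdj S).Preconnected := by
  rw [spanningAdj_preconnected_iff A]
  refine forall_congr' fun X => imp_congr_right fun _ => imp_congr_right fun _ => ?_
  constructor
  · rintro (⟨f, hf⟩ | ⟨f, -, -, hf, -⟩)
    · by_cases hfS : f ∈ S
      · exact ⟨f, hfS, by tauto⟩
      · simp [hfS] at hf
    · by_cases hfS : f ∈ S <;> simp [hfS] at hf
  · rintro ⟨e, he, hc⟩
    replace he : e ∈ S := he
    refine Or.inl ⟨e, ?_⟩
    simp only [he, if_true, true_or, and_true]
    tauto

-- States of nonzero weight correspond to their sets of surviving edges.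
open Classical in
theorem sum_deleteWeight [Fintype E(G)] (A : G.FullOrientation) (p : ℝ) :
    ∑ σ : E(G) → Option SignType, (∏ e, deleteWeight p (σ e)) *
      (if Good A.tailVertex A.headVertex σ then 1 else 0) =
    ∑ S : Finset E(G), (1 - p) ^ S.card * p ^ (Nat.card E(G) - S.card) *
      (if (G.spanningAdj S).Preconnected then 1 else 0) := by
  symm
  refine Fintype.sum_of_injective
    (fun S : Finset E(G) => fun e => if e ∈ S then some (0 : SignType) else none) ?_ _ _ ?_ ?_
  · intro S T hST
    ext e
    have := congrFun hST e
    by_cases h1 : e ∈ S <;> by_cases h2 : e ∈ T <;> simp_all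
  · intro σ hσ
    refine mul_eq_zero_of_left ?_ _
    by_contra h0
    rw [← ne_eq, Finset.prod_ne_zero_iff] at h0
    refine hσ ⟨Finset.univ.filter fun e => σ e = some 0, funext fun e => ?_⟩
    have := h0 e (Finset.mem_univ e)
    simp only [Finset.mem_filter, Finset.mem_univ, true_and]
    revert this
    rcases σ e with _ | x
    · simp
    · by_cases hx : x = 0 <;> simp [deleteWeight, hx]
  · intro S
    simp only [good_unoriented_iff]
    congr 1
    have : ∀ e, deleteWeight p (if e ∈ S then some 0 else none) = if e ∈ S then 1 - p else p := by
      intro e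
      by_cases he : e ∈ S <;> simp [he, deleteWeight]
    simp only [this]
    rw [Finset.prod_ite]
    simp [Finset.filter_notMem_eq_sdiff, ← Finset.compl_eq_univ_sdiff, Finset.card_compl]

namespace FullOrientation

/-- The two notions differ only on empty cuts, on which cut minimality is vacuous; connectedness of
`G` excludes these. -/
theorem good_iff_isCutMinimal [Finite E(G)] (A : G.FullOrientation) (hG : G.IsConnected)
    (O : G.PartialOrientation) :
    Good A.tailVertex A.headVertex (fun e => some (O e)) ↔ A.IsCutMinimal O := by
  constructor
  · rintro H _ ⟨Y, hYV, hY, hY', rfl, hO⟩ e ⟨heC, hmin⟩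
    obtain ⟨X, rfl⟩ : ∃ X : Set V(G), Y = Subtype.val '' X :=
      ⟨Subtype.val ⁻¹' Y, by rw [Subtype.image_preimage_coe, Set.inter_eq_right.2 hYV]⟩
    have hX' : Xᶜ.Nonempty := by
      obtain ⟨v, hv, hv'⟩ := hY'
      exact ⟨⟨v, hv⟩, fun h => hv' ⟨_, h, rfl⟩⟩
    obtain ⟨f, h1, h2, h3, h4⟩ := (H X (Set.image_nonempty.1 hY) hX').resolve_left
      ((A.forall_mem_cut_oriented_iff O X).1 hO)
    rcases (A.exists_orientedFromTo_iff O X e).1 (hO e heC) with ⟨h, -⟩ | ⟨h, ha, hb⟩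
    · exact h
    · have hlt := h4 e ha hb (congrArg some h)
      exact absurd (hmin ((A.mem_cut_image_iff X f).2 (by tauto))) (not_le.2 hlt)
  · rintro H X hX ⟨v, hv⟩
    by_cases hb : Blocked A.tailVertex A.headVertex (fun e => some (O e)) X
    · exact Or.inl hb
    right
    have hO := (A.forall_mem_cut_oriented_iff O X).2 hb
    obtain ⟨e₀, -, he₀⟩ := (spanningAdj_preconnected_iff A Set.univ).1 hG.preconnected X hX ⟨v, hv⟩
    obtain ⟨e, he, hmin⟩ := (Set.toFinite (G.cut (Subtype.val '' X))).exists_minimal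
      ⟨e₀, (A.mem_cut_image_iff X e₀).2 he₀⟩
    replace hmin : e ∈ lowerBounds (G.cut (Subtype.val '' X)) := fun f hf =>
      (le_total e f).elim id (hmin hf)
    have h1 : O e = 1 := H _ ⟨_, by simp, hX.image _,
      ⟨v, v.2, fun ⟨w, hw, h⟩ => hv (Subtype.ext h ▸ hw)⟩, rfl, hO⟩ e ⟨he, hmin⟩
    rcases (A.exists_orientedFromTo_iff O X e).1 (hO e he) with ⟨-, ha, hb⟩ | ⟨h, -⟩
    · refine ⟨e, ha, hb, congrArg some h1, fun f hf hf' hneg => ?_⟩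
      refine lt_of_le_of_ne (hmin ((A.mem_cut_image_iff X f).2 (by tauto))) ?_
      rintro rfl
      exact hb hf
    · rw [h1] at h
      exact absurd h (by decide)

end FullOrientation

end Graph

theorem mainTheorem10 {α β : Type*} (G : Graph α β) [Fintype V(G)] [Fintype E(G)]
    (hG : G.IsConnected) [LinearOrder E(G)] (A : G.FullOrientation)
    (p : ℝ) (hp0 : 0 < p) (hp : p < 1 / 2) :
    (G.randomPartialOrientation p).real {O | A.IsCutMinimal O} = G.reliability p := by
  classical
  rw [Graph.randomPartialOrientation_real hp0 hp, Graph.reliability_eq_sum hG hp0]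
  trans ∑ σ : E(G) → Option SignType, (∏ e, CutMinimal.orientWeight p (σ e)) *
    (if CutMinimal.Good A.tailVertex A.headVertex σ then 1 else 0)
  swap
  · trans ∑ σ : E(G) → Option SignType, (∏ e, CutMinimal.deleteWeight p (σ e)) *
      (if CutMinimal.Good A.tailVertex A.headVertex σ then 1 else 0)
    · convert CutMinimal.sum_orientWeight_eq_sum_deleteWeight A.tailVertex A.headVertex p
    · convert Graph.sum_deleteWeight A p
  -- `orientWeight` vanishes at `none`, so only genuine partial orientations contribute.
  refine Fintype.sum_of_injective (fun (O : G.PartialOrientation) e => some (O e)) ?_ _ _ ?_ ?_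
  · exact fun O O' h => funext fun e => Option.some.inj (congrFun h e)
  · intro σ hσ
    refine mul_eq_zero_of_left ?_ _
    by_contra h0
    rw [← ne_eq, Finset.prod_ne_zero_iff] at h0
    have hs : ∀ e, ∃ s, σ e = some s := fun e => Option.ne_none_iff_exists'.1 fun hn =>
      h0 e (Finset.mem_univ e) (by rw [hn, CutMinimal.orientWeight])
    choose O hO using hs
    exact hσ ⟨O, funext fun e => (hO e).symm⟩
  · intro O
    simp only [A.good_iff_isCutMinimal hG, Set.mem_ofPred_eq]
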